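/- For integers $d\ge 1$ and $2\le k\le r$ let $T(d,r,k)$ denote the smallest positive integer $n$ such that for every list $a_1,\dots,a_n$ of (not necessarily distinct) points in $\mathbb{R}^d$ there is a partition $N_1,\dots,N_r$ of the index set $\{1,\dots,n\}$ such that every $k$ of the $r$ convex hulls $\operatorname{conv}\{a_i : i\in N_j\}$ $(j=1,\dots,r)$ have a point in common, and let $T(d,r)=(d+1)(r-1)+1$. Then $$T(5,3,2)=T(5,3)=13 .$$ Moreover, a family of $12$-point sets showing $T(5,3,2)>12$ is the following. Let $p_0,\dots,p_5\in\mathbb{R}^5$ satisfy $\sum_{i=0}^5 p_i=0$, with each five of the $p_i$ linearly independent, and on each open ray $R_i=\{\lambda p_i:\lambda>0\}$ choose two distinct points $P_{i,0},P_{i,1}$. Replace the three points $P_{0,1},P_{5,1},P_{2,1}$ by $$P_{0,1}+\varepsilon_1(p_1+2p_2+3p_3+4p_4+5p_5),\quad P_{5,1}+\varepsilon_2(5p_0+4p_1+3p_2+2p_3+p_4),\quad P_{2,1}+\varepsilon_3(p_0+p_4),$$ and keep the other nine. Then for all sufficiently small $\varepsilon_1>0$, for all sufficiently small $\varepsilon_2>0$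 (depending on $\varepsilon_1$) and for all sufficiently small $\varepsilon_3>0$ (depending on $\varepsilon_1,\varepsilon_2$), the resulting $12$ points are distinct, and in every partition of them into three parts some two parts have disjoint convex hulls. -/

import Mathlib

open Filter Topology

/-- The convex hull of the part with label `j` of a family of points `a`, where the indices are
divided into labelled disjoint parts by `c` (the `j`-th part is the set of indices `i` with
`c i = j`). Empty parts are not excluded; their convex hull is empty. -/
def partHull {ι : Type*} {d r : ℕ} (a : ι → EuclideanSpace ℝ (Fin d)) (c : ι → Fin r)
    (j : Fin r) : Set (EuclideanSpace ℝ (Fin d)) :=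
  convexHull ℝ (a '' {i | c i = j})

/-- Every list of `n` points in `ℝ^d` (repetitions allowed) has an `r`-partition of its indices
such that every `k` of the `r` convex hulls have a point in common. -/
def ReayProperty (d r k n : ℕ) : Prop :=
  ∀ a : Fin n → EuclideanSpace ℝ (Fin d), ∃ c : Fin n → Fin r,
    ∀ J : Finset (Fin r), J.card = k → (⋂ j ∈ J, partHull a c j).Nonempty

/-- `T(d, r, k)`: the smallest positive integer `n` with the property above. -/
noncomputable def reayNumber (d r k : ℕ) : ℕ :=
  sInf {n : ℕ | 0 < n ∧ ReayProperty d r k n}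

/-- The Tverberg number `T(d, r) = (d + 1)(r - 1) + 1`, for `r ≥ 1`. -/
def tverbergNumber (d r : ℕ) : ℕ := (d + 1) * (r - 1) + 1

/-- `p 0, …, p d` are the vertices of a `d`-simplex centered at the origin: they sum to zero and
each `d` of them are linearly independent. -/
def IsCenteredSimplex {d : ℕ} (p : Fin (d + 1) → EuclideanSpace ℝ (Fin d)) : Prop :=
  ∑ i, p i = 0 ∧ ∀ i, LinearIndependent ℝ (fun j : {j : Fin (d + 1) // j ≠ i} => p j)

/-- The point with coordinates `u` with respect to the spanning vectors `p 0, …, p 5`. -/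
noncomputable def simplexPoint (p : Fin 6 → EuclideanSpace ℝ (Fin 5)) (u : Fin 6 → ℝ) :
    EuclideanSpace ℝ (Fin 5) :=
  ∑ i, u i • p i

/-- The twelve points: `lam i 0 • p i` and `lam i 1 • p i` on the ray through `p i`, after moving
the points with indices `(0, 1)`, `(5, 1)`, `(2, 1)` by `ε₁`, `ε₂`, `ε₃` times the vectors with
coordinates `(0,1,2,3,4,5)`, `(5,4,3,2,1,0)`, `(1,0,0,0,1,0)`. -/
noncomputable def perturbedPoints (p : Fin 6 → EuclideanSpace ℝ (Fin 5))
    (lam : Fin 6 → Fin 2 → ℝ) (ε₁ ε₂ ε₃ : ℝ) :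
    Fin 6 × Fin 2 → EuclideanSpace ℝ (Fin 5) := fun x =>
  lam x.1 x.2 • p x.1 +
    (if x = (0, 1) then ε₁ • simplexPoint p ![0, 1, 2, 3, 4, 5]
     else if x = (5, 1) then ε₂ • simplexPoint p ![5, 4, 3, 2, 1, 0]
     else if x = (2, 1) then ε₃ • simplexPoint p ![1, 0, 0, 0, 1, 0]
     else 0)

/-! The upper bound is Tverberg's theorem, by Sarkaria's tensor trick from colourful Carathéodory
(`exists_tverberg_partition`).

For the lower bound, suppose the hulls of colours `i` and `j` meet. Subtracting the two convex
representations gives signed weights `u` (`IsCrossing`). As the `p r` satisfy only the relation `∑ p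
r = 0`, the coefficient on every ray has one value `t`. This coefficient is `lam r 0 * u (r, 0) +
lam r 1 * u (r, 1)` plus a small displacement `δ r`. If `j` misses ray `a` and `i` misses ray `b`,
then `δ a ≤ t ≤ δ b`. So `t` is small, and the weights are small on every ray not shared by `i` and
`j`. A single shared ray cannot carry the weights `1` and `-1` at distinct positions, so every pair
of colours shares at least two rays. With three pairs and six rays, each pair shares exactly two.

The inequality `δ a ≤ δ b` now becomes combinatorial. In each application one moved point lies on a
ray shared by the two colours considered and dominates `δ`. The vectors `(0,1,2,3,4,5)`,
`(5,4,3,2,1,0)` and `(1,0,0,0,1,0)` thus constrain how the three pairs occupy the rays, and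
`false_of_order_constraints` shows that no arrangement survives. -/

theorem mem_partHull_iff {ι : Type*} [Fintype ι] {d r : ℕ} {a : ι → EuclideanSpace ℝ (Fin d)}
    {c : ι → Fin r} {j : Fin r} {x : EuclideanSpace ℝ (Fin d)} :
    x ∈ partHull a c j ↔ ∃ w : ι → ℝ, (∀ i, 0 ≤ w i) ∧ (∀ i, c i ≠ j → w i = 0) ∧
      ∑ i, w i = 1 ∧ ∑ i, w i • a i = x := by
  classical
  constructor
  · intro hx
    refine convexHull_min (t := {x | ∃ w : ι → ℝ, (∀ i, 0 ≤ w i) ∧ (∀ i, c i ≠ j → w i = 0) ∧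
      ∑ i, w i = 1 ∧ ∑ i, w i • a i = x}) ?_ ?_ hx
    · rintro _ ⟨i, hi, rfl⟩
      refine ⟨Pi.single i 1, fun k => ?_, fun k hk => ?_, by simp, ?_⟩
      · by_cases h : k = i
        · subst h; simp
        · simp [h]
      · have : k ≠ i := by rintro rfl; exact hk hi
        simp [this]
      · simp [Pi.single_apply, ite_smul]
    · rintro _ ⟨w, h0, hc, h1, rfl⟩ _ ⟨w', h0', hc', h1', rfl⟩ s t hs ht hst
      refine ⟨fun i => s * w i + t * w' i, fun i => ?_, fun i hi => ?_, ?_, ?_⟩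
      · have := h0 i; have := h0' i; positivity
      · simp [hc i hi, hc' i hi]
      · rw [Finset.sum_add_distrib, ← Finset.mul_sum, ← Finset.mul_sum, h1, h1']; linarith
      · simp only [add_smul, Finset.sum_add_distrib, mul_smul, Finset.smul_sum]
  · rintro ⟨w, h0, hc, h1, rfl⟩
    have hs : ∀ {M : Type} [AddCommMonoid M] (g : ι → M), (∀ i, c i ≠ j → g i = 0) →
        ∑ i ∈ Finset.univ.filter (fun i => c i = j), g i = ∑ i, g i := by
      intro M _ g hg
      rw [Finset.sum_filter]
      refine Finset.sum_congr rfl fun i _ => ?_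
      by_cases h : c i = j
      · simp [h]
      · simp [h, hg i h]
    rw [← hs _ (fun i hi => by rw [hc i hi, zero_smul])]
    refine (convex_convexHull ℝ _).sum_mem (fun i _ => h0 i) ((hs w hc).trans h1) fun i hi => ?_
    exact subset_convexHull ℝ _ ⟨i, by simpa using hi, rfl⟩

/-! ### Colourful Carathéodory, by minimising the distance from the origin. -/

section ColorfulCaratheodory

variable {V : Type*} [NormedAddCommGroup V] [InnerProductSpace ℝ V]

open scoped InnerProductSpace

theorem Convex.norm_sq_le_inner_of_forall_norm_le {K : Set V} (hK : Convex ℝ K) {z w : V}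
    (hz : z ∈ K) (hw : w ∈ K) (hmin : ∀ x ∈ K, ‖z‖ ≤ ‖x‖) : ‖z‖ ^ 2 ≤ ⟪z, w⟫_ℝ := by
  have : Nonempty K := ⟨⟨z, hz⟩⟩
  have h : ‖(0 : V) - z‖ = ⨅ x : K, ‖(0 : V) - x‖ := by
    refine le_antisymm (le_ciInf fun x => ?_) (ciInf_le ⟨0, ?_⟩ (⟨z, hz⟩ : K))
    · simpa using hmin x x.2
    · rintro _ ⟨x, rfl⟩
      exact norm_nonneg _
  have := (norm_eq_iInf_iff_real_inner_le_zero hK hz).1 h w hw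
  rw [zero_sub, inner_neg_left, inner_sub_right, real_inner_self_eq_norm_sq] at this
  linarith

/-- A point of minimal norm in the convex hull of finitely many points lies in the convex hull of a
proper subfamily, if the dimension is smaller than the number of points. -/
theorem exists_mem_convexHull_image_compl_singleton [FiniteDimensional ℝ V] {ι : Type*} [Fintype ι]
    (hcard : Module.finrank ℝ V < Fintype.card ι) {g : ι → V} {z : V} (hz0 : z ≠ 0)
    (hz : z ∈ convexHull ℝ (Set.range g))
    (hmin : ∀ x ∈ convexHull ℝ (Set.range g), ‖z‖ ≤ ‖x‖) :
    ∃ i, z ∈ convexHull ℝ (g '' {i}ᶜ) := by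
  obtain ⟨κ, hκ, y, w, hy, hind, hpos, hsum, hcomb⟩ := eq_pos_convex_span_of_mem_convexHull hz
  -- Minimality puts each support point in the half-space `⟪z, ·⟫ ≥ ‖z‖ ^ 2`. Their weighted mean
  -- `z` is on its boundary, so all of them are; an affinely independent family in this hyperplane
  -- has at most `finrank` members.
  have hle : ∀ k, 0 ≤ w k * (⟪z, y k⟫_ℝ - ‖z‖ ^ 2) := fun k =>
    mul_nonneg (hpos k).le (sub_nonneg.2 ((convex_convexHull ℝ _).norm_sq_le_inner_of_forall_norm_le
      hz (subset_convexHull ℝ _ (hy ⟨k, rfl⟩)) hmin))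
  have htot : ∑ k, w k * (⟪z, y k⟫_ℝ - ‖z‖ ^ 2) = 0 := by
    have h1 : ∑ k, w k * ⟪z, y k⟫_ℝ = ‖z‖ ^ 2 := by
      rw [← real_inner_self_eq_norm_sq]
      conv_rhs => rw [← hcomb]
      rw [hcomb, ← hcomb, inner_sum]
      refine Finset.sum_congr rfl fun k _ => ?_
      rw [hcomb, inner_smul_right]
    simp only [mul_sub, Finset.sum_sub_distrib, ← Finset.sum_mul, h1, hsum]
    ring
  have hin : ∀ k, ⟪z, y k⟫_ℝ = ‖z‖ ^ 2 := fun k => by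
    have := (Finset.sum_eq_zero_iff_of_nonneg (fun k _ => hle k)).1 htot k (Finset.mem_univ k)
    rcases mul_eq_zero.1 this with h | h
    · exact absurd h (hpos k).ne'
    · linarith
  have hspan : vectorSpan ℝ (Set.range y) ≤ (ℝ ∙ z)ᗮ := by
    rw [vectorSpan_def, Submodule.span_le]
    rintro _ ⟨_, ⟨k, rfl⟩, _, ⟨l, rfl⟩, rfl⟩
    rw [SetLike.mem_coe, Submodule.mem_orthogonal_singleton_iff_inner_right]
    simp [inner_sub_right, hin]
  have hκcard : Fintype.card κ ≤ Module.finrank ℝ V := by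
    have : Nonempty κ := by
      by_contra h
      rw [not_nonempty_iff] at h
      simp at hsum
    have h1 := hind.finrank_vectorSpan_add_one
    have h2 := Submodule.finrank_mono hspan
    have h3 := Submodule.finrank_add_finrank_orthogonal (ℝ ∙ z)
    rw [finrank_span_singleton hz0] at h3
    omega
  choose idx hidx using fun k => hy ⟨k, rfl⟩
  have hns : ¬ Function.Surjective idx := fun h => by
    have := Fintype.card_le_of_surjective idx h
    omega
  simp only [Function.Surjective, not_forall, not_exists] at hns
  obtain ⟨i, hi⟩ := hns
  refine ⟨i, mem_convexHull_of_exists_fintype w y (fun k => (hpos k).le) hsum (fun k => ?_) hcomb⟩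
  exact ⟨idx k, hi k, hidx k⟩

/-- Bárány's colourful Carathéodory theorem. -/
theorem exists_zero_mem_convexHull_range_of_forall [FiniteDimensional ℝ V] {ι κ : Type*}
    [Fintype ι] [Finite κ] (hcard : Module.finrank ℝ V < Fintype.card ι) (f : ι → κ → V)
    (hf : ∀ i, (0 : V) ∈ convexHull ℝ (Set.range (f i))) :
    ∃ s : ι → κ, (0 : V) ∈ convexHull ℝ (Set.range fun i => f i (s i)) := by
  classical
  have : Nonempty ι := Fintype.card_pos_iff.1 (by omega)
  have : Nonempty κ := by
    obtain ⟨_, k, -⟩ := convexHull_nonempty_iff.1 ⟨0, hf (Classical.arbitrary ι)⟩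
    exact ⟨k⟩
  have hz : ∀ s : ι → κ, ∃ z ∈ convexHull ℝ (Set.range fun i => f i (s i)),
      ∀ x ∈ convexHull ℝ (Set.range fun i => f i (s i)), ‖z‖ ≤ ‖x‖ := fun s =>
    ((Set.finite_range _).isCompact_convexHull (𝕜 := ℝ)).exists_isMinOn
      (convexHull_nonempty_iff.2 (Set.range_nonempty _)) continuous_norm.continuousOn
  choose z hzmem hzmin using hz
  obtain ⟨s, hs⟩ := Finite.exists_min fun s => ‖z s‖
  refine ⟨s, ?_⟩
  by_cases h0 : z s = 0
  · exact h0 ▸ hzmem s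
  exfalso
  -- The vertex of colour `i` can be exchanged without losing `z s`. Since `0` is in the hull of `f
  -- i`, it can be exchanged for one with `⟪z s, f i k⟫ ≤ 0`, which contradicts the minimality of
  -- `‖z s‖` over all transversals.
  obtain ⟨i, hi⟩ := exists_mem_convexHull_image_compl_singleton hcard h0 (hzmem s) (hzmin s)
  obtain ⟨k, hk⟩ : ∃ k, ⟪z s, f i k⟫_ℝ ≤ 0 := by
    by_contra! h
    have : (0 : V) ∈ {x : V | 0 < ⟪z s, x⟫_ℝ} := by
      refine convexHull_min ?_ ?_ (hf i)
      · rintro _ ⟨k, rfl⟩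
        exact h k
      · exact convex_halfSpace_gt (innerₗ V (z s)).isLinear 0
    simp at this
  have hsub : (fun i => f i (s i)) '' {i}ᶜ ⊆
      Set.range fun j => f j (Function.update s i k j) := by
    rintro _ ⟨j, hj, rfl⟩
    exact ⟨j, by simp [Function.update_of_ne hj]⟩
  have h1 := (convex_convexHull ℝ _).norm_sq_le_inner_of_forall_norm_le
    (convexHull_mono hsub hi) (subset_convexHull ℝ _ ⟨i, rfl⟩)
    fun x hx => (hs (Function.update s i k)).trans (hzmin _ x hx)
  simp only [Function.update_self] at h1
  have : 0 < ‖z s‖ := norm_pos_iff.2 h0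
  nlinarith

end ColorfulCaratheodory

/-! ### Tverberg's theorem, by Sarkaria's tensor trick. -/

section Tverberg

/-- The vectors `e_0, …, e_{q-1}, -(e_0 + ⋯ + e_{q-1})` in `ℝ^q`. -/
def sarkariaVector (q : ℕ) (j : Fin (q + 1)) (k : Fin q) : ℝ :=
  if j = k.castSucc then 1 else if j = Fin.last q then -1 else 0

theorem sum_sarkariaVector (q : ℕ) (k : Fin q) : ∑ j, sarkariaVector q j k = 0 := by
  have : ∀ j, sarkariaVector q j k =
      (if j = k.castSucc then 1 else 0) - (if j = Fin.last q then 1 else 0) := by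
    intro j
    unfold sarkariaVector
    have := (Fin.castSucc_lt_last k).ne'
    split_ifs <;> simp_all
  simp [this]

theorem sum_mul_sarkariaVector {ι : Type*} [Fintype ι] {q : ℕ} (c : ι → Fin (q + 1)) (g : ι → ℝ)
    (k : Fin q) : ∑ i, g i * sarkariaVector q (c i) k =
      ∑ i, (if c i = k.castSucc then g i else 0) - ∑ i, (if c i = Fin.last q then g i else 0) := by
  rw [← Finset.sum_sub_distrib]
  refine Finset.sum_congr rfl fun i _ => ?_
  unfold sarkariaVector
  have := (Fin.castSucc_lt_last k).ne'
  split_ifs <;> simp_all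

/-- Coordinates of the point `x` lifted to height one. -/
noncomputable def affineLift {d : ℕ} (x : EuclideanSpace ℝ (Fin d)) (m : Option (Fin d)) : ℝ :=
  m.elim 1 x

/-- **Tverberg's theorem**. -/
theorem exists_tverberg_partition {d q n : ℕ} (hn : q * (d + 1) < n)
    (a : Fin n → EuclideanSpace ℝ (Fin d)) :
    ∃ c : Fin n → Fin (q + 1), (⋂ j, partHull a c j).Nonempty := by
  -- The tensors of the lifted point `a i` with the `q + 1` Sarkaria vectors have barycentre zero
  -- and live in dimension `q * (d + 1) < n`.
  let f : Fin n → Fin (q + 1) → EuclideanSpace ℝ (Fin q × Option (Fin d)) := fun i j =>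
    WithLp.toLp 2 fun km => affineLift (a i) km.2 * sarkariaVector q j km.1
  have hf : ∀ i, 0 ∈ convexHull ℝ (Set.range (f i)) := fun i => by
    refine mem_convexHull_of_exists_fintype (ι := Fin (q + 1)) (fun _ => ((q : ℝ) + 1)⁻¹) (f i)
      (fun _ => by positivity) ?_ (fun j => ⟨j, rfl⟩) ?_
    · simp; field_simp
    · rw [← Finset.smul_sum]
      convert smul_zero _
      ext km
      simp [f, ← Finset.mul_sum, sum_sarkariaVector]
  obtain ⟨c, hc⟩ := exists_zero_mem_convexHull_range_of_forall (by simpa using hn) f hf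
  refine ⟨c, ?_⟩
  obtain ⟨w, hw0, hw1, hw⟩ : ∃ w : Fin n → ℝ, (∀ i, 0 ≤ w i) ∧ ∑ i, w i = 1 ∧
      ∑ i, w i • f i (c i) = 0 := by
    rw [convexHull_range_eq_exists_affineCombination] at hc
    obtain ⟨s, w, h0, h1, h2⟩ := hc
    rw [Finset.affineCombination_eq_linear_combination _ _ _ h1] at h2
    refine ⟨fun i => if i ∈ s then w i else 0, fun i => ?_, ?_, ?_⟩
    · dsimp only
      split_ifs with h
      exacts [h0 i h, le_rfl]
    · simpa using h1
    · simpa [ite_smul] using h2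
  have hkey : ∀ j m, ∑ i, (if c i = j then w i * affineLift (a i) m else 0) =
      ∑ i, (if c i = Fin.last q then w i * affineLift (a i) m else 0) := by
    intro j m
    induction j using Fin.lastCases with
    | last => rfl
    | cast k =>
      rw [← sub_eq_zero, ← sum_mul_sarkariaVector c (fun i => w i * affineLift (a i) m) k]
      have := congrArg (fun v : EuclideanSpace ℝ (Fin q × Option (Fin d)) => v (k, m)) hw
      simpa [f, mul_assoc] using this
  set W : ℝ := ∑ i, (if c i = Fin.last q then w i else 0) with hW
  have hWj : ∀ j, ∑ i, (if c i = j then w i else 0) = W := fun j => by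
    simpa [affineLift] using hkey j none
  have hqW : ((q : ℝ) + 1) * W = 1 := by
    have h : ∑ j, ∑ i, (if c i = j then w i else 0) = 1 := by
      rw [Finset.sum_comm, ← hw1]
      simp
    simpa [hWj] using h
  have hWpos : 0 < W := by
    by_contra! h
    nlinarith [(Nat.cast_nonneg q : (0 : ℝ) ≤ q)]
  refine ⟨W⁻¹ • ∑ i, (if c i = Fin.last q then w i else 0) • a i, Set.mem_iInter.2 fun j => ?_⟩
  refine mem_partHull_iff.2 ⟨fun i => W⁻¹ * (if c i = j then w i else 0), fun i => ?_,
    fun i hi => by simp [hi], ?_, ?_⟩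
  · have := hw0 i
    positivity
  · rw [← Finset.mul_sum, hWj, inv_mul_cancel₀ hWpos.ne']
  · simp only [mul_smul, ← Finset.smul_sum]
    congr 1
    ext m
    simpa [affineLift, -ite_smul] using hkey j (some m)

theorem reayProperty_tverbergNumber {d r k : ℕ} (hr : 1 ≤ r) :
    ReayProperty d r k (tverbergNumber d r) := by
  obtain ⟨q, rfl⟩ := Nat.exists_eq_add_of_le' hr
  intro a
  obtain ⟨c, x, hx⟩ := exists_tverberg_partition (q := q)
    (by simp [tverbergNumber, mul_comm]) a
  exact ⟨c, fun J _ => ⟨x, Set.mem_iInter₂.2 fun j _ => Set.mem_iInter.1 hx j⟩⟩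

end Tverberg

/-! ### Size estimates for the weights of a crossing. -/

section Crossing

/-- Signed weights on twelve points lying near six rays, witnessing that the convex hulls of the
points of colours `i` and `j` intersect: `lam r b` is the position of the point `(r, b)` on its ray,
and `δ r` is the contribution of the displacements to the coordinate `r`. Coordinates are only
determined up to a common summand, whence `t`. -/
structure IsCrossing (c : Fin 6 × Fin 2 → Fin 3) (i j : Fin 3) (lam : Fin 6 → Fin 2 → ℝ)
    (δ : Fin 6 → ℝ) (u : Fin 6 × Fin 2 → ℝ) (t : ℝ) : Prop where
  nonneg : ∀ x, c x = i → 0 ≤ u x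
  nonpos : ∀ x, c x = j → u x ≤ 0
  eq_zero : ∀ x, c x ≠ i → c x ≠ j → u x = 0
  sum_left : ∑ x, (if c x = i then u x else 0) = 1
  sum_right : ∑ x, (if c x = j then u x else 0) = -1
  balance : ∀ r, lam r 0 * u (r, 0) + lam r 1 * u (r, 1) + δ r = t

/-- The colour `i` occurs on the ray `r`. -/
abbrev OccursOn (c : Fin 6 × Fin 2 → Fin 3) (i : Fin 3) (r : Fin 6) : Prop :=
  c (r, 0) = i ∨ c (r, 1) = i

/-- The two points of the ray `r` have the colours `i` and `j`. -/
abbrev IsCommonRay (c : Fin 6 × Fin 2 → Fin 3) (i j : Fin 3) (r : Fin 6) : Prop :=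
  (c (r, 0) = i ∧ c (r, 1) = j) ∨ (c (r, 0) = j ∧ c (r, 1) = i)

/-- All positions on the rays, and the gaps between the two positions on a ray, are at least `m`,
and all positions are at most `M`. -/
structure IsSpread (lam : Fin 6 → Fin 2 → ℝ) (m M : ℝ) : Prop where
  le : ∀ r b, m ≤ lam r b
  le_gap : ∀ r, m ≤ |lam r 0 - lam r 1|
  ge : ∀ r b, lam r b ≤ M

namespace IsCrossing

variable {c : Fin 6 × Fin 2 → Fin 3} {i j : Fin 3} {lam : Fin 6 → Fin 2 → ℝ} {δ : Fin 6 → ℝ}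
  {u : Fin 6 × Fin 2 → ℝ} {t m M : ℝ}

theorem nonneg_of_ne (h : IsCrossing c i j lam δ u t) {x : Fin 6 × Fin 2} (hx : c x ≠ j) :
    0 ≤ u x := by
  by_cases hi : c x = i
  · exact h.nonneg x hi
  · exact (h.eq_zero x hi hx).ge

theorem nonpos_of_ne (h : IsCrossing c i j lam δ u t) {x : Fin 6 × Fin 2} (hx : c x ≠ i) :
    u x ≤ 0 := by
  by_cases hj : c x = j
  · exact h.nonpos x hj
  · exact (h.eq_zero x hx hj).le

theorem le_of_not_occursOn (h : IsCrossing c i j lam δ u t) (hm : 0 < m) (hlam : IsSpread lam m M)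
    {r : Fin 6} (hr : ¬ OccursOn c j r) : δ r ≤ t := by
  have h0 := mul_nonneg (hm.le.trans (hlam.le r 0)) (h.nonneg_of_ne fun e => hr (Or.inl e))
  have h1 := mul_nonneg (hm.le.trans (hlam.le r 1)) (h.nonneg_of_ne fun e => hr (Or.inr e))
  linarith [h.balance r]

theorem ge_of_not_occursOn (h : IsCrossing c i j lam δ u t) (hm : 0 < m) (hlam : IsSpread lam m M)
    {r : Fin 6} (hr : ¬ OccursOn c i r) : t ≤ δ r := by
  have h0 := mul_nonneg (hm.le.trans (hlam.le r 0))
    (neg_nonneg.2 (h.nonpos_of_ne fun e => hr (Or.inl e)))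
  have h1 := mul_nonneg (hm.le.trans (hlam.le r 1))
    (neg_nonneg.2 (h.nonpos_of_ne fun e => hr (Or.inr e)))
  linarith [h.balance r]

/-- Off the common rays both weights of a ray have the same sign, so nothing cancels in `balance`.
-/
theorem abs_le_of_not_isCommonRay (h : IsCrossing c i j lam δ u t) (hm : 0 < m)
    (hlam : IsSpread lam m M) {r : Fin 6} (hr : ¬ IsCommonRay c i j r) (b : Fin 2) :
    m * |u (r, b)| ≤ |t - δ r| := by
  have key : ∀ x y : ℝ, (0 ≤ x ∧ 0 ≤ y ∨ x ≤ 0 ∧ y ≤ 0) →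
      t - δ r = lam r 0 * x + lam r 1 * y → m * |x| ≤ |t - δ r| ∧ m * |y| ≤ |t - δ r| := by
    intro x y hxy he
    have l0 := hlam.le r 0
    have l1 := hlam.le r 1
    rw [he]
    rcases hxy with ⟨hx, hy⟩ | ⟨hx, hy⟩
    · have := mul_nonneg (hm.le.trans l0) hx
      have := mul_nonneg (hm.le.trans l1) hy
      have := mul_le_mul_of_nonneg_right l0 hx
      have := mul_le_mul_of_nonneg_right l1 hy
      rw [abs_of_nonneg hx, abs_of_nonneg hy, abs_of_nonneg (by linarith)]
      constructor <;> linarith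
    · have := mul_nonneg (hm.le.trans l0) (neg_nonneg.2 hx)
      have := mul_nonneg (hm.le.trans l1) (neg_nonneg.2 hy)
      have := mul_le_mul_of_nonneg_right l0 (neg_nonneg.2 hx)
      have := mul_le_mul_of_nonneg_right l1 (neg_nonneg.2 hy)
      rw [abs_of_nonpos hx, abs_of_nonpos hy, abs_of_nonpos (by linarith)]
      constructor <;> linarith
  have hsign : 0 ≤ u (r, 0) ∧ 0 ≤ u (r, 1) ∨ u (r, 0) ≤ 0 ∧ u (r, 1) ≤ 0 := by
    by_cases h0 : c (r, 0) = i
    · by_cases h1 : c (r, 1) = j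
      · exact absurd (Or.inl ⟨h0, h1⟩) hr
      · exact Or.inl ⟨h.nonneg _ h0, h.nonneg_of_ne h1⟩
    · by_cases h1 : c (r, 1) = i
      · by_cases h2 : c (r, 0) = j
        · exact absurd (Or.inr ⟨h2, h1⟩) hr
        · exact Or.inl ⟨h.nonneg_of_ne h2, h.nonneg _ h1⟩
      · exact Or.inr ⟨h.nonpos_of_ne h0, h.nonpos_of_ne h1⟩
  obtain ⟨k0, k1⟩ := key _ _ hsign (by linarith [h.balance r])
  fin_cases b
  exacts [k0, k1]

theorem abs_le_one (h : IsCrossing c i j lam δ u t) (x : Fin 6 × Fin 2) : |u x| ≤ 1 := by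
  by_cases hi : c x = i
  · have := Finset.single_le_sum (f := fun x => if c x = i then u x else 0)
      (fun y _ => by split_ifs with hy; exacts [h.nonneg y hy, le_rfl])
      (Finset.mem_univ x)
    rw [h.sum_left] at this
    simp only [hi, if_true] at this
    rw [abs_of_nonneg (h.nonneg x hi)]
    exact this
  by_cases hj : c x = j
  · have := Finset.single_le_sum (f := fun x => -(if c x = j then u x else 0))
      (fun y _ => by
        split_ifs with hy; exacts [neg_nonneg.2 (h.nonpos y hy), neg_zero.ge])
      (Finset.mem_univ x)
    rw [Finset.sum_neg_distrib, h.sum_right] at this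
    simp only [hj, if_true] at this
    rw [abs_of_nonpos (h.nonpos x hj)]
    linarith
  · simp [h.eq_zero x hi hj]

theorem exists_colour_left (h : IsCrossing c i j lam δ u t) : ∃ x, c x = i := by
  by_contra! hc
  have := h.sum_left
  simp [hc] at this

end IsCrossing

/-- If all terms outside the ray `r₀` are at most `η` in absolute value, then the sum over that ray
differs by at most `10 η` from the total. -/
theorem abs_sum_ray_sub_le {f : Fin 6 × Fin 2 → ℝ} {r₀ : Fin 6} {η s : ℝ}
    (hf : ∀ r b, r ≠ r₀ → |f (r, b)| ≤ η) (hs : ∑ x, f x = s) :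
    |f (r₀, 0) + f (r₀, 1) - s| ≤ 10 * η := by
  rw [Fintype.sum_prod_type, ← Finset.add_sum_erase _ _ (Finset.mem_univ r₀)] at hs
  simp only [Fin.sum_univ_two] at hs
  have h1 : |∑ r ∈ Finset.univ.erase r₀, (f (r, 0) + f (r, 1))| ≤
      ∑ r ∈ Finset.univ.erase r₀, 2 * η := by
    refine (Finset.abs_sum_le_sum_abs _ _).trans (Finset.sum_le_sum fun r hr => ?_)
    have hr' := Finset.ne_of_mem_erase hr
    linarith [abs_add_le (f (r, 0)) (f (r, 1)), hf r 0 hr', hf r 1 hr']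
  rw [Finset.sum_const, Finset.card_erase_of_mem (Finset.mem_univ _)] at h1
  norm_num at h1
  rw [← hs, abs_sub_comm]
  simpa [mul_comm, mul_assoc, ← mul_assoc] using le_trans h1 (by linarith)

namespace IsCrossing

variable {c : Fin 6 × Fin 2 → Fin 3} {i j : Fin 3} {lam : Fin 6 → Fin 2 → ℝ} {δ : Fin 6 → ℝ}
  {u : Fin 6 × Fin 2 → ℝ} {t m M η D : ℝ}

/-- The weights are not concentrated on a single ray. -/
theorem exists_lt_abs (h : IsCrossing c i j lam δ u t) (hij : i ≠ j) (hm : 0 < m)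
    (hlam : IsSpread lam m M) (hη : 0 ≤ η) (hM : 10 * η < 1) (hD : 20 * η * M + 2 * D < m)
    {r₀ : Fin 6} (hr₀ : |t - δ r₀| ≤ 2 * D) : ∃ r b, r ≠ r₀ ∧ η < |u (r, b)| := by
  by_contra! hsmall
  have hsmall' : ∀ k, ∀ r b, r ≠ r₀ → |(if c (r, b) = k then u (r, b) else 0)| ≤ η := by
    intro k r b hr
    split_ifs
    · exact hsmall r b hr
    · simpa using hη
  -- Since `10 * η < 1`, both colours must occur on `r₀`, with weights close to `1` and `-1`. Their
  -- positions differ by at least `m`, too much for the balance `2 * D`.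
  have hi := abs_sum_ray_sub_le (hsmall' i) h.sum_left
  have hj := abs_sum_ray_sub_le (hsmall' j) h.sum_right
  rw [abs_le] at hi hj
  have key : ∀ x y l l' : ℝ, 0 < l → 0 < l' → l ≤ M → l' ≤ M → |x - 1| ≤ 10 * η →
      |y + 1| ≤ 10 * η → m ≤ |l - l'| → |l * x + l' * y| ≤ 2 * D → False := by
    intro x y l l' hl hl' hlM hlM' hx hy hgap hg
    have e : l - l' = (l * x + l' * y) - l * (x - 1) - l' * (y + 1) := by ring
    have a1 : |l * (x - 1)| ≤ M * (10 * η) := by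
      rw [abs_mul, abs_of_pos hl]
      exact mul_le_mul hlM hx (abs_nonneg _) (hl.le.trans hlM)
    have a2 : |l' * (y + 1)| ≤ M * (10 * η) := by
      rw [abs_mul, abs_of_pos hl']
      exact mul_le_mul hlM' hy (abs_nonneg _) (hl.le.trans hlM)
    rw [e] at hgap
    have b1 := abs_sub (l * x + l' * y - l * (x - 1)) (l' * (y + 1))
    have b2 := abs_sub (l * x + l' * y) (l * (x - 1))
    linarith
  have hbal : t - δ r₀ = lam r₀ 0 * u (r₀, 0) + lam r₀ 1 * u (r₀, 1) := by
    linarith [h.balance r₀]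
  rw [hbal] at hr₀
  have p0 := hm.trans_le (hlam.le r₀ 0)
  have p1 := hm.trans_le (hlam.le r₀ 1)
  by_cases h0 : c (r₀, 0) = i
  · by_cases h1 : c (r₀, 1) = j
    · simp only [h0, h1, if_true, hij, hij.symm, if_false] at hi hj
      exact key _ _ _ _ p0 p1 (hlam.ge r₀ 0) (hlam.ge r₀ 1)
        (abs_le.2 ⟨by linarith, by linarith⟩) (abs_le.2 ⟨by linarith, by linarith⟩)
        (hlam.le_gap r₀) hr₀
    · simp only [h0, h1, hij, if_false] at hj
      linarith
  · by_cases h1 : c (r₀, 1) = i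
    · by_cases h2 : c (r₀, 0) = j
      · simp only [h1, h2, if_true, hij, hij.symm, if_false] at hi hj
        refine key (u (r₀, 1)) (u (r₀, 0)) _ _ p1 p0 (hlam.ge r₀ 1) (hlam.ge r₀ 0)
          (abs_le.2 ⟨by linarith, by linarith⟩) (abs_le.2 ⟨by linarith, by linarith⟩) ?_ ?_
        · rw [abs_sub_comm]
          exact hlam.le_gap r₀
        · rwa [add_comm]
      · simp only [h1, h2, hij, if_false] at hj
        linarith
    · simp only [h0, h1, if_false] at hi
      linarith

/-- If neither colour occurs on all rays, then each ray can be avoided by a ray common to both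
colours. -/
theorem exists_isCommonRay_ne (h : IsCrossing c i j lam δ u t) (hij : i ≠ j) (hm : 0 < m)
    (hlam : IsSpread lam m M) (hη : 10 * η < 1) (hD : 20 * η * M + 2 * D < m)
    (hDη : 2 * D ≤ m * η) (hδ : ∀ r, |δ r| ≤ D) (hi : ∃ r, ¬ OccursOn c i r)
    (hj : ∃ r, ¬ OccursOn c j r) :
    (∀ r, |t - δ r| ≤ 2 * D) ∧ ∀ r₀, ∃ r b, r ≠ r₀ ∧ IsCommonRay c i j r ∧ η < |u (r, b)| := by
  obtain ⟨ri, hri⟩ := hi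
  obtain ⟨rj, hrj⟩ := hj
  have h1 := h.le_of_not_occursOn hm hlam hrj
  have h2 := h.ge_of_not_occursOn hm hlam hri
  have ht : ∀ r, |t - δ r| ≤ 2 * D := fun r => by
    have := abs_le.1 (hδ r)
    have := abs_le.1 (hδ ri)
    have := abs_le.1 (hδ rj)
    exact abs_le.2 ⟨by linarith, by linarith⟩
  have hη0 : 0 ≤ η := by
    have := (abs_nonneg _).trans (hδ 0)
    exact le_of_mul_le_mul_left (by linarith) hm
  refine ⟨ht, fun r₀ => ?_⟩
  obtain ⟨r, b, hr, hb⟩ := h.exists_lt_abs hij hm hlam hη0 hη hD (ht r₀)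
  refine ⟨r, b, hr, ?_, hb⟩
  by_contra hc
  have := h.abs_le_of_not_isCommonRay hm hlam hc b
  have := mul_lt_mul_of_pos_left hb hm
  linarith [ht r]

/-- If the colours `i` and `j` have just two common rays, then all weights on them are bounded
below. -/
theorem le_abs_of_isCommonRay (h : IsCrossing c i j lam δ u t) (hij : i ≠ j) (hm : 0 < m)
    (hlam : IsSpread lam m M) (hη : 10 * η < 1) (hD : 20 * η * M + 2 * D < m)
    (hDη : 4 * D ≤ m * η) (hδ : ∀ r, |δ r| ≤ D) (hi : ∃ r, ¬ OccursOn c i r)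
    (hj : ∃ r, ¬ OccursOn c j r) {r₀ r₁ : Fin 6}
    (htwo : ∀ r, IsCommonRay c i j r → r = r₀ ∨ r = r₁) {κ : ℝ} (hκη : κ ≤ η)
    (hκ : 2 * M * κ ≤ m * η) (b : Fin 2) : κ ≤ |u (r₀, b)| := by
  have hD0 : 0 ≤ D := (abs_nonneg _).trans (hδ 0)
  obtain ⟨ht, hex⟩ := h.exists_isCommonRay_ne hij hm hlam hη hD (by linarith) hδ hi hj
  -- Avoiding `r₁` forces the heavy weight onto `r₀`; the balance there then makes its partner heavy
  -- too.
  obtain ⟨r, b', hr, hcr, hb'⟩ := hex r₁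
  obtain rfl := (htwo r hcr).resolve_right hr
  have key : ∀ x y l l' : ℝ, m ≤ l → m ≤ l' → l' ≤ M → |l * x + l' * y| ≤ 2 * D → η < |x| →
      κ ≤ |y| := by
    intro x y l l' hl hl' hlM hg hx
    by_contra! hy
    have e : l * x = (l * x + l' * y) - l' * y := by ring
    have a1 : |l * x| ≤ 2 * D + M * |y| := by
      rw [e]
      refine (abs_sub _ _).trans (add_le_add hg ?_)
      rw [abs_mul, abs_of_pos (hm.trans_le hl')]
      exact mul_le_mul_of_nonneg_right hlM (abs_nonneg _)
    rw [abs_mul, abs_of_pos (hm.trans_le hl)] at a1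
    have a2 : m * η < l * |x| :=
      (mul_lt_mul_of_pos_left hx hm).trans_le (mul_le_mul_of_nonneg_right hl (abs_nonneg _))
    have a3 : M * |y| ≤ M * κ := mul_le_mul_of_nonneg_left hy.le (by linarith)
    linarith
  have hbal : lam r 0 * u (r, 0) + lam r 1 * u (r, 1) = t - δ r := by linarith [h.balance r]
  have htr := ht r
  rw [← hbal] at htr
  have k0 : η < |u (r, 0)| → κ ≤ |u (r, 1)| :=
    key _ _ _ _ (hlam.le r 0) (hlam.le r 1) (hlam.ge r 1) htr
  have k1 : η < |u (r, 1)| → κ ≤ |u (r, 0)| :=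
    key _ _ _ _ (hlam.le r 1) (hlam.le r 0) (hlam.ge r 0) (by rwa [add_comm])
  fin_cases b <;> fin_cases b' <;> simp only [Fin.zero_eta, Fin.mk_one] at hb' ⊢
  exacts [hκη.trans hb'.le, k1 hb', k0 hb', hκη.trans hb'.le]

end IsCrossing

end Crossing

/-! ### Displacements dominated by one of their three terms. -/

section Tilt

/-- The displacement of the coordinate `r` in a signed combination of the perturbed points, where
the three moved points have coefficients `E₁ / ε₁`, `E₂ / ε₂` and `E₃ / ε₃`. -/
noncomputable def tilt (E₁ E₂ E₃ : ℝ) (r : Fin 6) : ℝ :=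
  E₁ * (r : ℕ) + E₂ * (5 - (r : ℕ)) + E₃ * (if r = 0 ∨ r = 4 then 1 else 0)

theorem abs_tilt_sub_le (E₁ E₂ E₃ : ℝ) (r r' : Fin 6) :
    |tilt E₁ E₂ E₃ r - tilt E₁ E₂ E₃ r'| ≤ 5 * |E₁| + 5 * |E₂| + |E₃| := by
  have e : tilt E₁ E₂ E₃ r - tilt E₁ E₂ E₃ r' = E₁ * ((r : ℕ) - (r' : ℕ) : ℝ) +
      E₂ * ((r' : ℕ) - (r : ℕ) : ℝ) +
      E₃ * ((if r = 0 ∨ r = 4 then 1 else 0) - (if r' = 0 ∨ r' = 4 then 1 else 0)) := by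
    unfold tilt; ring
  have h1 : |((r : ℕ) - (r' : ℕ) : ℝ)| ≤ 5 := by
    have a : ((r : ℕ) : ℝ) ≤ 5 := by exact_mod_cast Nat.le_of_lt_succ r.2
    have b : ((r' : ℕ) : ℝ) ≤ 5 := by exact_mod_cast Nat.le_of_lt_succ r'.2
    have a' : (0 : ℝ) ≤ ((r : ℕ) : ℝ) := Nat.cast_nonneg _
    have b' : (0 : ℝ) ≤ ((r' : ℕ) : ℝ) := Nat.cast_nonneg _
    exact abs_le.2 ⟨by linarith, by linarith⟩
  have h2 : |((r' : ℕ) - (r : ℕ) : ℝ)| ≤ 5 := by rwa [abs_sub_comm]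
  have h3 : |((if r = 0 ∨ r = 4 then 1 else 0) - (if r' = 0 ∨ r' = 4 then 1 else 0) : ℝ)| ≤ 1 := by
    split_ifs <;> norm_num
  rw [e]
  refine (abs_add_three _ _ _).trans ?_
  rw [abs_mul, abs_mul, abs_mul]
  have := mul_le_mul_of_nonneg_left h1 (abs_nonneg E₁)
  have := mul_le_mul_of_nonneg_left h2 (abs_nonneg E₂)
  have := mul_le_mul_of_nonneg_left h3 (abs_nonneg E₃)
  linarith

theorem abs_tilt_le (E₁ E₂ E₃ : ℝ) (r : Fin 6) :
    |tilt E₁ E₂ E₃ r| ≤ 5 * |E₁| + 5 * |E₂| + |E₃| := by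
  have h1 : |((r : ℕ) : ℝ)| ≤ 5 := by
    rw [Nat.abs_cast]; exact_mod_cast Nat.le_of_lt_succ r.2
  have h2 : |(5 - (r : ℕ) : ℝ)| ≤ 5 := by
    have a : ((r : ℕ) : ℝ) ≤ 5 := by exact_mod_cast Nat.le_of_lt_succ r.2
    have a' : (0 : ℝ) ≤ ((r : ℕ) : ℝ) := Nat.cast_nonneg _
    exact abs_le.2 ⟨by linarith, by linarith⟩
  have h3 : |(if r = 0 ∨ r = 4 then 1 else 0 : ℝ)| ≤ 1 := by
    split_ifs <;> norm_num
  refine (abs_add_three _ _ _).trans ?_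
  rw [abs_mul, abs_mul, abs_mul]
  have := mul_le_mul_of_nonneg_left h1 (abs_nonneg E₁)
  have := mul_le_mul_of_nonneg_left h2 (abs_nonneg E₂)
  have := mul_le_mul_of_nonneg_left h3 (abs_nonneg E₃)
  linarith

variable {E₁ E₂ E₃ : ℝ} {r r' : Fin 6}

/-- The leading term rises by `E₁` per ray, while the other two vary by at most `5 * |E₂| + |E₃|` in
all. -/
theorem le_of_tilt_le_of_dominant_first (hE : 5 * |E₂| + |E₃| < E₁)
    (h : tilt E₁ E₂ E₃ r ≤ tilt E₁ E₂ E₃ r') : r ≤ r' := by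
  by_contra! hlt
  have h1 : ((r' : ℕ) : ℝ) + 1 ≤ (r : ℕ) := by exact_mod_cast hlt
  have h2 := (abs_le.1 (abs_tilt_sub_le 0 E₂ E₃ r r')).1
  have e : tilt E₁ E₂ E₃ r - tilt E₁ E₂ E₃ r' =
      E₁ * ((r : ℕ) - (r' : ℕ)) + (tilt 0 E₂ E₃ r - tilt 0 E₂ E₃ r') := by unfold tilt; ring
  have h0 : 0 < E₁ := lt_of_le_of_lt (by positivity) hE
  rw [abs_zero] at h2
  nlinarith

theorem le_of_tilt_le_of_dominant_second (hE : 5 * |E₁| + |E₃| < E₂)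
    (h : tilt E₁ E₂ E₃ r ≤ tilt E₁ E₂ E₃ r') : r' ≤ r := by
  by_contra! hlt
  have h1 : ((r : ℕ) : ℝ) + 1 ≤ (r' : ℕ) := by exact_mod_cast hlt
  have h2 := (abs_le.1 (abs_tilt_sub_le E₁ 0 E₃ r r')).1
  have e : tilt E₁ E₂ E₃ r - tilt E₁ E₂ E₃ r' =
      E₂ * ((r' : ℕ) - (r : ℕ)) + (tilt E₁ 0 E₃ r - tilt E₁ 0 E₃ r') := by unfold tilt; ring
  have h0 : 0 < E₂ := lt_of_le_of_lt (by positivity) hE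
  rw [abs_zero] at h2
  nlinarith

theorem imp_of_tilt_le_of_dominant_third (hE : 5 * |E₁| + 5 * |E₂| < E₃)
    (h : tilt E₁ E₂ E₃ r ≤ tilt E₁ E₂ E₃ r') : r = 0 ∨ r = 4 → r' = 0 ∨ r' = 4 := by
  intro hr
  by_contra hr'
  have h2 := (abs_le.1 (abs_tilt_sub_le E₁ E₂ 0 r r')).1
  have e : tilt E₁ E₂ E₃ r - tilt E₁ E₂ E₃ r' =
      E₃ + (tilt E₁ E₂ 0 r - tilt E₁ E₂ 0 r') := by
    simp only [tilt, if_pos hr, if_neg hr']; ring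
  rw [abs_zero] at h2
  linarith

end Tilt

/-! ### Order constraints imposed by the three moved points. -/

section Order

/-- The perturbation parameters are small, each one compared with the preceding one. -/
structure IsSmallHierarchy (m κ ε₁ ε₂ ε₃ : ℝ) : Prop where
  pos₁ : 0 < ε₁
  pos₂ : 0 < ε₂
  pos₃ : 0 < ε₃
  le₁ : 100 * ε₁ ≤ m
  le₂ : 20 * ε₂ ≤ κ * ε₁
  le₃ : 20 * ε₃ ≤ κ * ε₂

namespace IsCrossing

variable {c : Fin 6 × Fin 2 → Fin 3} {i j : Fin 3} {lam : Fin 6 → Fin 2 → ℝ}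
  {u : Fin 6 × Fin 2 → ℝ} {t m M ε₁ ε₂ ε₃ κ : ℝ} {a b : Fin 6}

/-- This is a bootstrap: when `(r, s)` is itself a moved point, its weight also appears on the
right, with a factor small against `m`, and can be absorbed. Its displacement is then negligible
even if its `ε` is the larger one. -/
theorem abs_weight_le_of_not_isCommonRay {E₁ E₂ E₃ : ℝ}
    (h : IsCrossing c i j lam (tilt E₁ E₂ E₃) u t) (hm : 0 < m) (hlam : IsSpread lam m M)
    (ha : ¬ OccursOn c j a) (hb : ¬ OccursOn c i b) {r : Fin 6} (hr : ¬ IsCommonRay c i j r)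
    (s : Fin 2) : m * |u (r, s)| ≤ 5 * |E₁| + 5 * |E₂| + |E₃| := by
  refine (h.abs_le_of_not_isCommonRay hm hlam hr s).trans (abs_le.2 ⟨?_, ?_⟩)
  · linarith [h.le_of_not_occursOn hm hlam ha, (abs_le.1 (abs_tilt_sub_le E₁ E₂ E₃ a r)).1]
  · linarith [h.ge_of_not_occursOn hm hlam hb, (abs_le.1 (abs_tilt_sub_le E₁ E₂ E₃ b r)).2]

theorem tilt_le_tilt {E₁ E₂ E₃ : ℝ}
    (h : IsCrossing c i j lam (tilt E₁ E₂ E₃) u t) (hm : 0 < m) (hlam : IsSpread lam m M)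
    (ha : ¬ OccursOn c j a) (hb : ¬ OccursOn c i b) : tilt E₁ E₂ E₃ a ≤ tilt E₁ E₂ E₃ b :=
  (h.le_of_not_occursOn hm hlam ha).trans (h.ge_of_not_occursOn hm hlam hb)

theorem le_of_common_first
    (h : IsCrossing c i j lam (tilt (ε₁ * u (0, 1)) (ε₂ * u (5, 1)) (ε₃ * u (2, 1))) u t)
    (hm : 0 < m) (hlam : IsSpread lam m M) (hε : IsSmallHierarchy m κ ε₁ ε₂ ε₃) (hκ1 : κ ≤ 1)
    (ha : ¬ OccursOn c j a) (hb : ¬ OccursOn c i b) (hi : c (0, 1) = i) (hκ : κ ≤ |u (0, 1)|) :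
    a ≤ b := by
  obtain ⟨p1, p2, p3, -, l2, l3⟩ := hε
  refine le_of_tilt_le_of_dominant_first ?_ (h.tilt_le_tilt hm hlam ha hb)
  rw [abs_of_nonneg (h.nonneg _ hi)] at hκ
  rw [abs_mul, abs_mul, abs_of_pos p2, abs_of_pos p3]
  have := mul_le_mul_of_nonneg_left (h.abs_le_one (5, 1)) p2.le
  have := mul_le_mul_of_nonneg_left (h.abs_le_one (2, 1)) p3.le
  have := mul_le_mul_of_nonneg_left hκ p1.le
  have := mul_le_mul_of_nonneg_right hκ1 p2.le
  linarith

/-- Although `ε₁` exceeds `ε₂`, ray `0` is not common, so the first displacement is absorbed by the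
bootstrap; the third is negligible because `ε₃` is small. In `imp_of_common_third` both earlier
displacements are absorbed. -/
theorem le_of_common_second
    (h : IsCrossing c i j lam (tilt (ε₁ * u (0, 1)) (ε₂ * u (5, 1)) (ε₃ * u (2, 1))) u t)
    (hm : 0 < m) (hlam : IsSpread lam m M) (hε : IsSmallHierarchy m κ ε₁ ε₂ ε₃)
    (ha : ¬ OccursOn c j a) (hb : ¬ OccursOn c i b) (h0 : ¬ IsCommonRay c i j 0)
    (hi : c (5, 1) = i) (hκ : κ ≤ |u (5, 1)|) : b ≤ a := by
  obtain ⟨p1, p2, p3, l1, l2, l3⟩ := hε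
  refine le_of_tilt_le_of_dominant_second ?_ (h.tilt_le_tilt hm hlam ha hb)
  have w := h.abs_weight_le_of_not_isCommonRay hm hlam ha hb h0 1
  have q : 0 ≤ u (5, 1) := h.nonneg _ hi
  rw [abs_of_nonneg q] at hκ
  rw [abs_mul, abs_mul, abs_mul, abs_of_pos p1, abs_of_pos p2, abs_of_pos p3, abs_of_nonneg q] at w
  rw [abs_mul, abs_mul, abs_of_pos p1, abs_of_pos p3]
  have := mul_le_mul_of_nonneg_left (h.abs_le_one (2, 1)) p3.le
  have := mul_le_mul_of_nonneg_left hκ p2.le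
  have := mul_le_mul_of_nonneg_right l1 (abs_nonneg (u (0, 1)))
  linarith

theorem imp_of_common_third
    (h : IsCrossing c i j lam (tilt (ε₁ * u (0, 1)) (ε₂ * u (5, 1)) (ε₃ * u (2, 1))) u t)
    (hm : 0 < m) (hlam : IsSpread lam m M) (hε : IsSmallHierarchy m κ ε₁ ε₂ ε₃) (hκ0 : 0 < κ)
    (hκ1 : κ ≤ 1) (ha : ¬ OccursOn c j a) (hb : ¬ OccursOn c i b) (h0 : ¬ IsCommonRay c i j 0)
    (h5 : ¬ IsCommonRay c i j 5) (hi : c (2, 1) = i) (hκ : κ ≤ |u (2, 1)|) :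
    a = 0 ∨ a = 4 → b = 0 ∨ b = 4 := by
  obtain ⟨p1, p2, p3, l1, l2, l3⟩ := hε
  refine imp_of_tilt_le_of_dominant_third ?_ (h.tilt_le_tilt hm hlam ha hb)
  have w0 := h.abs_weight_le_of_not_isCommonRay hm hlam ha hb h0 1
  have w5 := h.abs_weight_le_of_not_isCommonRay hm hlam ha hb h5 1
  have q : 0 ≤ u (2, 1) := h.nonneg _ hi
  rw [abs_of_nonneg q] at hκ
  simp only [abs_mul, abs_of_pos p1, abs_of_pos p2, abs_of_pos p3, abs_of_nonneg q] at w0 w5 ⊢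
  have hpos : 0 < ε₃ * u (2, 1) := mul_pos p3 (hκ0.trans_le hκ)
  have := mul_le_mul_of_nonneg_right l1 (abs_nonneg (u (0, 1)))
  have l1' : 100 * ε₂ ≤ m := by nlinarith
  have := mul_le_mul_of_nonneg_right l1' (abs_nonneg (u (5, 1)))
  linarith

end IsCrossing

end Order

/-! ### Distribution of three colours over six rays. -/

section Combinatorics

/-- If any two colours, neither of which occurs on all rays, have a common ray, then no colour
occurs on all rays. -/
theorem exists_not_occursOn {c : Fin 6 × Fin 2 → Fin 3} (hc : ∀ i, ∃ x, c x = i)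
    (hcommon : ∀ i j, i ≠ j → (∃ r, ¬ OccursOn c i r) → (∃ r, ¬ OccursOn c j r) →
      ∃ r, IsCommonRay c i j r) (i : Fin 3) : ∃ r, ¬ OccursOn c i r := by
  by_contra! hi
  obtain ⟨j, k, hij, hik, hjk⟩ : ∃ j k : Fin 3, i ≠ j ∧ i ≠ k ∧ j ≠ k := by
    clear hi; revert i; decide
  have hmiss : ∀ j k : Fin 3, i ≠ j → i ≠ k → j ≠ k → ∃ r, ¬ OccursOn c j r := by
    intro j k hij hik hjk
    -- A ray carrying `k` also carries `i`, which leaves no room for `j`. Hence `j` and `k` both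
    -- miss rays and share one, where `i` cannot fit.
    obtain ⟨⟨r, b⟩, hx⟩ := hc k
    refine ⟨r, fun hj => ?_⟩
    have := hi r
    fin_cases b <;> grind
  obtain ⟨r, hr⟩ := hcommon j k hjk (hmiss j k hij hik hjk) (hmiss k j hik hij hjk.symm)
  have := hi r
  grind

/-- If any two colours have at least two common rays, then any two colours have exactly two, and
each ray carries two colours. -/
theorem common_rays_of_two_le {c : Fin 6 × Fin 2 → Fin 3}
    (h : ∀ i j, i ≠ j → ∀ r₀, ∃ r, r ≠ r₀ ∧ IsCommonRay c i j r) :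
    (∀ r, c (r, 0) ≠ c (r, 1)) ∧ ∀ i j, i ≠ j → ∀ r₀, IsCommonRay c i j r₀ →
      ∃ r₁, ∀ r, IsCommonRay c i j r → r = r₀ ∨ r = r₁ := by
  classical
  let S : Fin 3 → Fin 3 → Finset (Fin 6) := fun i j => Finset.univ.filter (IsCommonRay c i j)
  have hS : ∀ i j, i ≠ j → 2 ≤ (S i j).card := by
    intro i j hij
    obtain ⟨r, -, hr⟩ := h i j hij 0
    obtain ⟨r', hne, hr'⟩ := h i j hij r
    exact Finset.one_lt_card.2 ⟨r', by simpa [S] using hr', r, by simpa [S] using hr, hne⟩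
  have key : ∀ i j k : Fin 3, i ≠ j → i ≠ k → j ≠ k →
      (S i j).card = 2 ∧ S i j ∪ (S i k ∪ S j k) = Finset.univ := by
    intro i j k hij hik hjk
    have d1 : Disjoint (S i k) (S j k) := by
      rw [Finset.disjoint_left]; intro r; simp only [S, Finset.mem_filter]; grind
    have d2 : Disjoint (S i j) (S i k ∪ S j k) := by
      rw [Finset.disjoint_left]; intro r
      simp only [S, Finset.mem_filter, Finset.mem_union]; grind
    have hle := Finset.card_le_univ (S i j ∪ (S i k ∪ S j k))
    have hcard : (S i j ∪ (S i k ∪ S j k)).card =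
        (S i j).card + ((S i k).card + (S j k).card) := by
      rw [Finset.card_union_of_disjoint d2, Finset.card_union_of_disjoint d1]
    have a1 := hS i j hij
    have a2 := hS i k hik
    have a3 := hS j k hjk
    rw [Fintype.card_fin] at hle
    refine ⟨by omega, Finset.eq_univ_of_card _ ?_⟩
    rw [Fintype.card_fin]
    omega
  constructor
  · intro r
    have := (key 0 1 2 (by decide) (by decide) (by decide)).2 ▸ Finset.mem_univ r
    simp only [S, Finset.mem_filter, Finset.mem_union] at this
    grind
  · intro i j hij r₀ hr₀
    obtain ⟨k, hik, hjk⟩ : ∃ k : Fin 3, i ≠ k ∧ j ≠ k := by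
      clear hr₀; revert i j; decide
    obtain ⟨x, y, -, hxy⟩ := Finset.card_eq_two.1 (key i j k hij hik hjk).1
    have hmem : ∀ r, IsCommonRay c i j r → r = x ∨ r = y := fun r hr => by
      have : r ∈ S i j := by simpa [S] using hr
      simpa [hxy] using this
    rcases hmem r₀ hr₀ with rfl | rfl
    · exact ⟨y, hmem⟩
    · exact ⟨x, fun r hr => (hmem r hr).symm⟩

set_option synthInstance.maxHeartbeats 400000 in
set_option synthInstance.maxSize 1000 in
set_option maxRecDepth 10000 in
/-- The order constraints coming from the three displacements are incompatible. -/
theorem false_of_order_constraints (f : Fin 6 → Fin 3) (h0 : f 0 = 0)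
    (h2 : ∀ k r₀, ∃ r, r ≠ r₀ ∧ f r = k)
    (hfirst : ∀ a b, f a = 1 → f b = 2 → a ≤ b)
    (hsecond : f 5 = 2 → (∀ a b, f a = 0 → f b = 1 → b ≤ a) ∨ (∀ a b, f a = 0 → f b = 1 → a ≤ b))
    (hthird : f 2 = 1 → f 5 ≠ 1 →
      (∀ a b, f a = 0 → f b = 2 → a = 0 ∨ a = 4 → b = 0 ∨ b = 4) ∨
      (∀ a b, f a = 0 → f b = 2 → b = 0 ∨ b = 4 → a = 0 ∨ a = 4)) : False := by
  -- Each label occurs exactly twice. The first two constraints leave only the labellings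
  -- `0,1,1,2,2,0` and `0,0,1,1,2,2`. In both, `{0, 4}` contains exactly one ray labelled `0` and
  -- one labelled `2`, so both alternatives of the third constraint fail.
  revert f
  decide

end Combinatorics

/-! ### No colouring has crossings for all pairs of colours. -/

section Colouring

/-- For small hierarchical perturbations no colouring admits crossings of all pairs of colours. -/
theorem exists_pair_not_isCrossing {lam : Fin 6 → Fin 2 → ℝ} {m M ε₁ ε₂ ε₃ κ η D : ℝ}
    (hm : 0 < m) (hlam : IsSpread lam m M) (hε : IsSmallHierarchy m κ ε₁ ε₂ ε₃) (hκ0 : 0 < κ)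
    (hη : 10 * η < 1) (hD : 20 * η * M + 2 * D < m) (hDη : 4 * D ≤ m * η) (hκη : κ ≤ η)
    (hκ : 2 * M * κ ≤ m * η) (hεD : 5 * ε₁ + 5 * ε₂ + ε₃ ≤ D) (c : Fin 6 × Fin 2 → Fin 3) :
    ∃ i j, i ≠ j ∧ ∀ u t,
      ¬ IsCrossing c i j lam (tilt (ε₁ * u (0, 1)) (ε₂ * u (5, 1)) (ε₃ * u (2, 1))) u t := by
  by_contra! hall
  have hD0 : 0 ≤ D := by linarith [hε.pos₁, hε.pos₂, hε.pos₃]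
  have hκ1 : κ ≤ 1 := by linarith
  choose! u t hu using hall
  have hδ : ∀ i j, i ≠ j → ∀ r, |tilt (ε₁ * u i j (0, 1)) (ε₂ * u i j (5, 1))
      (ε₃ * u i j (2, 1)) r| ≤ D := by
    intro i j hij r
    refine (abs_tilt_le _ _ _ _).trans (le_trans ?_ hεD)
    rw [abs_mul, abs_mul, abs_mul, abs_of_pos hε.pos₁, abs_of_pos hε.pos₂, abs_of_pos hε.pos₃]
    have := mul_le_mul_of_nonneg_left ((hu i j hij).abs_le_one (0, 1)) hε.pos₁.le
    have := mul_le_mul_of_nonneg_left ((hu i j hij).abs_le_one (5, 1)) hε.pos₂.le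
    have := mul_le_mul_of_nonneg_left ((hu i j hij).abs_le_one (2, 1)) hε.pos₃.le
    linarith
  have hcommon : ∀ i j, i ≠ j → (∃ r, ¬ OccursOn c i r) → (∃ r, ¬ OccursOn c j r) →
      ∀ r₀, ∃ r, r ≠ r₀ ∧ IsCommonRay c i j r := by
    intro i j hij hi hj r₀
    obtain ⟨r, -, hr, hcr, -⟩ := ((hu i j hij).exists_isCommonRay_ne hij hm hlam hη hD
      (by linarith) (hδ i j hij) hi hj).2 r₀
    exact ⟨r, hr, hcr⟩
  have hsurj : ∀ i, ∃ x, c x = i := fun i => by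
    obtain ⟨j, hij⟩ := exists_ne i
    exact (hu i j hij.symm).exists_colour_left
  have hmiss := exists_not_occursOn hsurj fun i j hij hi hj =>
    (hcommon i j hij hi hj 0).imp fun _ => And.right
  have hcommon' : ∀ i j, i ≠ j → ∀ r₀, ∃ r, r ≠ r₀ ∧ IsCommonRay c i j r :=
    fun i j hij => hcommon i j hij (hmiss i) (hmiss j)
  obtain ⟨hne, htwo⟩ := common_rays_of_two_le hcommon'
  have hlow : ∀ i j, i ≠ j → ∀ r, IsCommonRay c i j r → ∀ b, κ ≤ |u i j (r, b)| := by
    intro i j hij r hr b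
    obtain ⟨r₁, hr₁⟩ := htwo i j hij r hr
    exact (hu i j hij).le_abs_of_isCommonRay hij hm hlam hη hD hDη (hδ i j hij) (hmiss i) (hmiss j)
      hr₁ hκη hκ b
  obtain ⟨A, hA⟩ : ∃ A, c (0, 1) = A := ⟨_, rfl⟩
  obtain ⟨B, hB⟩ : ∃ B, c (0, 0) = B := ⟨_, rfl⟩
  have hAB : A ≠ B := by rw [← hA, ← hB]; exact (hne 0).symm
  obtain ⟨C, hAC, hBC, hC⟩ : ∃ C, A ≠ C ∧ B ≠ C ∧ ∀ x, x = A ∨ x = B ∨ x = C := by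
    clear hA hB; revert A B; decide
  -- Rays are labelled by their pair of colours: `0` for `A B`, `1` for `A C`, `2` for `B C`. The
  -- rays of one pair are those missing the third colour.
  let f : Fin 6 → Fin 3 := fun r =>
    if IsCommonRay c A B r then 0 else if IsCommonRay c A C r then 1 else 2
  have f0 : ∀ r, f r = 0 ↔ IsCommonRay c A B r := by intro r; simp only [f]; grind
  have f1 : ∀ r, f r = 1 ↔ IsCommonRay c A C r := by intro r; simp only [f]; grind
  have f2 : ∀ r, f r = 2 ↔ IsCommonRay c B C r := by
    intro r
    have := hC (c (r, 0))
    have := hC (c (r, 1))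
    have := hne r
    simp only [f]
    grind
  have m0 : ∀ r, f r = 0 → ¬ OccursOn c C r := by intro r; rw [f0]; grind
  have m1 : ∀ r, f r = 1 → ¬ OccursOn c B r := by intro r; rw [f1]; grind
  have m2 : ∀ r, f r = 2 → ¬ OccursOn c A r := by intro r; rw [f2]; grind
  have hf0 : f 0 = 0 := (f0 0).2 (Or.inr ⟨hB, hA⟩)
  have swap : ∀ {i j r}, IsCommonRay c i j r → IsCommonRay c j i r := fun h => h.symm
  refine false_of_order_constraints f hf0 ?_ ?_ ?_ ?_
  · intro k r₀
    fin_cases k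
    · exact (hcommon' A B hAB r₀).imp fun r hr => ⟨hr.1, (f0 r).2 hr.2⟩
    · exact (hcommon' A C hAC r₀).imp fun r hr => ⟨hr.1, (f1 r).2 hr.2⟩
    · exact (hcommon' B C hBC r₀).imp fun r hr => ⟨hr.1, (f2 r).2 hr.2⟩
  · intro a b ha hb
    exact (hu A B hAB).le_of_common_first hm hlam hε hκ1 (m1 a ha) (m2 b hb) hA
      (hlow A B hAB 0 ((f0 0).1 hf0) 1)
  · intro h5
    have h5' := (f2 5).1 h5
    have h0 : ¬ IsCommonRay c B C 0 := fun h => by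
      rw [(f2 0).2 h] at hf0
      exact absurd hf0 (by decide)
    -- The crossing is oriented so that the moved point has positive weight; its unknown colour
    -- accounts for the two alternatives.
    rcases h5' with ⟨-, h51⟩ | ⟨-, h51⟩
    · exact Or.inr fun a b ha hb => (hu C B hBC.symm).le_of_common_second hm hlam hε
        (m1 b hb) (m0 a ha) (fun h => h0 (swap h)) h51 (hlow C B hBC.symm 5 (swap ((f2 5).1 h5)) 1)
    · exact Or.inl fun a b ha hb => (hu B C hBC).le_of_common_second hm hlam hε
        (m0 a ha) (m1 b hb) h0 h51 (hlow B C hBC 5 ((f2 5).1 h5) 1)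
  · intro h2 h5
    have h2' := (f1 2).1 h2
    have h5' : ¬ IsCommonRay c A C 5 := fun h => h5 ((f1 5).2 h)
    have h0 : ¬ IsCommonRay c A C 0 := fun h => by
      rw [(f1 0).2 h] at hf0
      exact absurd hf0 (by decide)
    rcases h2' with ⟨-, h21⟩ | ⟨-, h21⟩
    · exact Or.inr fun a b ha hb => (hu C A hAC.symm).imp_of_common_third hm hlam hε hκ0 hκ1
        (m2 b hb) (m0 a ha) (fun h => h0 (swap h)) (fun h => h5' (swap h)) h21
        (hlow C A hAC.symm 2 (swap ((f1 2).1 h2)) 1)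
    · exact Or.inl fun a b ha hb => (hu A C hAC).imp_of_common_third hm hlam hε hκ0 hκ1
        (m0 a ha) (m2 b hb) h0 h5' h21 (hlow A C hAC 2 ((f1 2).1 h2) 1)

end Colouring

/-! ### From intersecting hulls to crossings, and the choice of constants. -/

section Geometry

variable {p : Fin 6 → EuclideanSpace ℝ (Fin 5)} {lam : Fin 6 → Fin 2 → ℝ}

theorem IsCenteredSimplex.exists_eq_of_sum_smul_eq_zero {d : ℕ}
    {p : Fin (d + 1) → EuclideanSpace ℝ (Fin d)} (hp : IsCenteredSimplex p)
    {g : Fin (d + 1) → ℝ} (hg : ∑ r, g r • p r = 0) : ∃ t, ∀ r, g r = t := by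
  refine ⟨g 0, fun r => ?_⟩
  by_cases hr : r = 0
  · rw [hr]
  have h1 : ∑ r, (g r - g 0) • p r = 0 := by
    simp only [sub_smul, Finset.sum_sub_distrib, ← Finset.smul_sum, hg, hp.1, smul_zero, sub_zero]
  have h2 : ∑ s : {s : Fin (d + 1) // s ≠ 0}, (g s - g 0) • p s = 0 := by
    rw [← h1, Fintype.sum_eq_add_sum_subtype_ne _ (0 : Fin (d + 1)), sub_self, zero_smul, zero_add]
  exact sub_eq_zero.1 (Fintype.linearIndependent_iff.1 (hp.2 0) _ h2 ⟨r, hr⟩)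

theorem sum_smul_perturbedPoints (ε₁ ε₂ ε₃ : ℝ) (u : Fin 6 × Fin 2 → ℝ) :
    ∑ x, u x • perturbedPoints p lam ε₁ ε₂ ε₃ x =
      ∑ r, (lam r 0 * u (r, 0) + lam r 1 * u (r, 1) +
        tilt (ε₁ * u (0, 1)) (ε₂ * u (5, 1)) (ε₃ * u (2, 1)) r) • p r := by
  simp [Fintype.sum_prod_type, Fin.sum_univ_six, perturbedPoints, simplexPoint, tilt]
  module

theorem exists_isCrossing_of_not_disjoint (hp : IsCenteredSimplex p) {ε₁ ε₂ ε₃ : ℝ}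
    {c : Fin 6 × Fin 2 → Fin 3} {i j : Fin 3} (hij : i ≠ j)
    (h : ¬ Disjoint (partHull (perturbedPoints p lam ε₁ ε₂ ε₃) c i)
      (partHull (perturbedPoints p lam ε₁ ε₂ ε₃) c j)) :
    ∃ u t, IsCrossing c i j lam (tilt (ε₁ * u (0, 1)) (ε₂ * u (5, 1)) (ε₃ * u (2, 1))) u t := by
  obtain ⟨x, hx, hx'⟩ := Set.not_disjoint_iff.1 h
  obtain ⟨w, w0, wc, w1, hw⟩ := mem_partHull_iff.1 hx
  obtain ⟨v, v0, vc, v1, hv⟩ := mem_partHull_iff.1 hx'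
  have hsum : ∑ x, (w x - v x) • perturbedPoints p lam ε₁ ε₂ ε₃ x = 0 := by
    simp only [sub_smul, Finset.sum_sub_distrib, hw, hv, sub_self]
  rw [sum_smul_perturbedPoints (p := p) (lam := lam) ε₁ ε₂ ε₃ fun x => w x - v x] at hsum
  obtain ⟨t, ht⟩ := hp.exists_eq_of_sum_smul_eq_zero hsum
  refine ⟨fun x => w x - v x, t, ?_, ?_, ?_, ?_, ?_, ht⟩
  · intro x hx
    have := w0 x
    rw [vc x (by rwa [hx])]
    linarith
  · intro x hx
    have := v0 x
    rw [wc x (by rw [hx]; exact hij.symm)]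
    linarith
  · intro x hi hj
    rw [wc x hi, vc x hj, sub_zero]
  · rw [← w1]
    refine Finset.sum_congr rfl fun x _ => ?_
    split_ifs with hx
    · rw [vc x (by rwa [hx]), sub_zero]
    · rw [wc x hx]
  · rw [← v1, ← Finset.sum_neg_distrib]
    refine Finset.sum_congr rfl fun x _ => ?_
    split_ifs with hx
    · rw [wc x (by rw [hx]; exact hij.symm), zero_sub]
    · rw [vc x hx, neg_zero]

/-- Two coinciding points, given colours of their own, would form a crossing of one-point parts,
which cannot have a common ray other than that of `x`. -/
theorem perturbedPoints_injective (hp : IsCenteredSimplex p) {m M η D ε₁ ε₂ ε₃ : ℝ}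
    (hm : 0 < m) (hlam : IsSpread lam m M) (hε₁ : 0 ≤ ε₁) (hε₂ : 0 ≤ ε₂) (hε₃ : 0 ≤ ε₃)
    (hη : 10 * η < 1) (hD : 20 * η * M + 2 * D < m) (hDη : 2 * D ≤ m * η)
    (hεD : 5 * ε₁ + 5 * ε₂ + ε₃ ≤ D) :
    Function.Injective (perturbedPoints p lam ε₁ ε₂ ε₃) := by
  intro x y hxy
  by_contra hne
  let c : Fin 6 × Fin 2 → Fin 3 := fun z => if z = x then 0 else if z = y then 1 else 2
  have c0 : ∀ z, c z = 0 ↔ z = x := by intro z; simp only [c]; grind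
  have c1 : ∀ z, c z = 1 ↔ z = y := by intro z; simp only [c]; grind
  have hnd : ¬ Disjoint (partHull (perturbedPoints p lam ε₁ ε₂ ε₃) c 0)
      (partHull (perturbedPoints p lam ε₁ ε₂ ε₃) c 1) := by
    refine Set.not_disjoint_iff.2 ⟨perturbedPoints p lam ε₁ ε₂ ε₃ x,
      subset_convexHull ℝ _ ⟨x, (c0 x).2 rfl, rfl⟩, ?_⟩
    rw [hxy]
    exact subset_convexHull ℝ _ ⟨y, (c1 y).2 rfl, rfl⟩
  obtain ⟨u, t, h⟩ := exists_isCrossing_of_not_disjoint hp (by decide) hnd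
  have hδ : ∀ r, |tilt (ε₁ * u (0, 1)) (ε₂ * u (5, 1)) (ε₃ * u (2, 1)) r| ≤ D := by
    intro r
    refine (abs_tilt_le _ _ _ _).trans (le_trans ?_ hεD)
    rw [abs_mul, abs_mul, abs_mul, abs_of_nonneg hε₁, abs_of_nonneg hε₂, abs_of_nonneg hε₃]
    have := mul_le_mul_of_nonneg_left (h.abs_le_one (0, 1)) hε₁
    have := mul_le_mul_of_nonneg_left (h.abs_le_one (5, 1)) hε₂
    have := mul_le_mul_of_nonneg_left (h.abs_le_one (2, 1)) hε₃
    linarith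
  have hray : ∀ z : Fin 6 × Fin 2, ∃ r, r ≠ z.1 := fun z => exists_ne z.1
  have hmiss : ∀ (k : Fin 3) (z : Fin 6 × Fin 2), (∀ z', c z' = k ↔ z' = z) →
      ∀ r, OccursOn c k r → r = z.1 := by
    rintro k z hk r (hr | hr)
    · exact congrArg Prod.fst ((hk _).1 hr)
    · exact congrArg Prod.fst ((hk _).1 hr)
  obtain ⟨-, hex⟩ := h.exists_isCommonRay_ne (by decide) hm hlam hη hD hDη hδ
    ((hray x).imp fun r hr h => hr (hmiss 0 x c0 r h))
    ((hray y).imp fun r hr h => hr (hmiss 1 y c1 r h))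
  obtain ⟨r, -, hr, hcr, -⟩ := hex x.1
  exact hr (hmiss 0 x c0 r (hcr.imp And.left And.right))

theorem exists_isSpread (hpos : ∀ i j, 0 < lam i j) (hne : ∀ i, lam i 0 ≠ lam i 1) :
    ∃ m M, 0 < m ∧ IsSpread lam m M := by
  obtain ⟨x, hx⟩ := Finite.exists_min fun x : Fin 6 × Fin 2 => lam x.1 x.2
  obtain ⟨y, hy⟩ := Finite.exists_max fun x : Fin 6 × Fin 2 => lam x.1 x.2
  obtain ⟨r, hr⟩ := Finite.exists_min fun r : Fin 6 => |lam r 0 - lam r 1|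
  refine ⟨min (lam x.1 x.2) |lam r 0 - lam r 1|, lam y.1 y.2,
    lt_min (hpos _ _) (abs_pos.2 (sub_ne_zero.2 (hne r))), ?_, ?_, ?_⟩
  · exact fun r b => (min_le_left _ _).trans (hx (r, b))
  · exact fun s => (min_le_right _ _).trans (hr s)
  · exact fun r b => hy (r, b)

theorem eventually_injective_and_exists_disjoint (hp : IsCenteredSimplex p)
    (hpos : ∀ i j, 0 < lam i j) (hne : ∀ i, lam i 0 ≠ lam i 1) :
    ∀ᶠ ε₁ in 𝓝[>] (0 : ℝ), ∀ᶠ ε₂ in 𝓝[>] (0 : ℝ), ∀ᶠ ε₃ in 𝓝[>] (0 : ℝ),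
      Function.Injective (perturbedPoints p lam ε₁ ε₂ ε₃) ∧
      ∀ c : Fin 6 × Fin 2 → Fin 3, ∃ i j : Fin 3, i ≠ j ∧
        Disjoint (partHull (perturbedPoints p lam ε₁ ε₂ ε₃) c i)
          (partHull (perturbedPoints p lam ε₁ ε₂ ε₃) c j) := by
  obtain ⟨m, M, hm, hlam⟩ := exists_isSpread hpos hne
  have hmM : m ≤ M := (hlam.le 0 0).trans (hlam.ge 0 0)
  have hM : 0 < M := hm.trans_le hmM
  -- Here `20 * η * M` is `m / 2`, and `D` will be `m * η / 4`, so `20 * η * M + 2 * D < m`; `κ`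
  -- gives equality in `2 * M * κ ≤ m * η`.
  obtain ⟨η, hη⟩ : ∃ η, η = m / (40 * M) := ⟨_, rfl⟩
  have hη0 : 0 < η := by rw [hη]; positivity
  have hηM : 40 * (η * M) = m := by rw [hη]; field_simp
  have hη1 : 40 * η ≤ 1 := by
    by_contra! h
    nlinarith
  obtain ⟨κ, hκ⟩ : ∃ κ, κ = m * η / (2 * M) := ⟨_, rfl⟩
  have hκ0 : 0 < κ := by rw [hκ]; positivity
  have hκM : 2 * M * κ = m * η := by rw [hκ]; field_simp
  have hκη : κ ≤ η := by
    by_contra! h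
    nlinarith
  have hmη : 0 < m * η := mul_pos hm hη0
  have hmη' : 40 * (m * η) ≤ m := by nlinarith
  filter_upwards [Ioo_mem_nhdsGT (show (0 : ℝ) < m * η / 50 by positivity)] with ε₁ h₁
  filter_upwards [Ioo_mem_nhdsGT (show (0 : ℝ) < κ * ε₁ / 20 by have := h₁.1; positivity)]
    with ε₂ h₂
  filter_upwards [Ioo_mem_nhdsGT (show (0 : ℝ) < κ * ε₂ / 20 by have := h₂.1; positivity)]
    with ε₃ h₃
  obtain ⟨p₁, l₁⟩ := h₁
  obtain ⟨p₂, l₂⟩ := h₂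
  obtain ⟨p₃, l₃⟩ := h₃
  have hε : IsSmallHierarchy m κ ε₁ ε₂ ε₃ :=
    ⟨p₁, p₂, p₃, by linarith, by linarith, by linarith⟩
  have q₂ : κ * ε₁ ≤ ε₁ := mul_le_of_le_one_left p₁.le (by linarith)
  have q₃ : κ * ε₂ ≤ ε₂ := mul_le_of_le_one_left p₂.le (by linarith)
  have hεD : 5 * ε₁ + 5 * ε₂ + ε₃ ≤ m * η / 4 := by linarith
  refine ⟨perturbedPoints_injective (η := η) hp hm hlam p₁.le p₂.le p₃.le (by linarith)
    (by linarith) (by linarith) hεD, fun c => ?_⟩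
  obtain ⟨i, j, hij, hnot⟩ := exists_pair_not_isCrossing hm hlam hε hκ0 (by linarith)
    (by linarith) (by linarith) hκη hκM.le hεD c
  refine ⟨i, j, hij, ?_⟩
  by_contra hd
  obtain ⟨u, t, h⟩ := exists_isCrossing_of_not_disjoint hp hij hd
  exact hnot u t h

end Geometry

/-! ### Existence of a simplex, monotonicity in `n`, and the value of the Reay number. -/

section ReayNumber

theorem exists_isCenteredSimplex (d : ℕ) :
    ∃ p : Fin (d + 1) → EuclideanSpace ℝ (Fin d), IsCenteredSimplex p := by
  classical
  let e : Fin d → EuclideanSpace ℝ (Fin d) := fun k => EuclideanSpace.single k 1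
  refine ⟨Fin.snoc e (-∑ k, e k), ?_, fun i => ?_⟩
  · simp [Fin.sum_univ_castSucc]
  · rw [Fintype.linearIndependent_iff]
    intro g hg
    -- Extended by zero at `i`, the relation has all coefficients equal, hence all zero.
    let G : Fin (d + 1) → ℝ := fun j => if h : j ≠ i then g ⟨j, h⟩ else 0
    have hGi : G i = 0 := by simp [G]
    have hGj : ∀ j : {j // j ≠ i}, G j = g j := fun j => by simp [G, j.2]
    have hG : ∑ j, G j •
        (Fin.snoc e (-∑ k, e k) : Fin (d + 1) → EuclideanSpace ℝ (Fin d)) j = 0 := by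
      rw [Fintype.sum_eq_add_sum_subtype_ne _ i, hGi, zero_smul, zero_add, ← hg]
      exact Finset.sum_congr rfl fun j _ => by rw [hGj]
    have hk : ∀ k : Fin d, G k.castSucc = G (Fin.last d) := by
      intro k
      have := congrArg (fun v : EuclideanSpace ℝ (Fin d) => v k) hG
      rw [Fin.sum_univ_castSucc] at this
      simp [e, Pi.single_apply] at this
      linarith
    have hconst : ∀ j, G j = G (Fin.last d) := fun j => by
      induction j using Fin.lastCases with
      | last => rfl
      | cast k => exact hk k
    intro j
    rw [← hGj, hconst, ← hconst i, hGi]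

theorem ReayProperty.mono {d r k n n' : ℕ} (hr : 0 < r) (hn : n ≤ n') (h : ReayProperty d r k n) :
    ReayProperty d r k n' := by
  intro a
  obtain ⟨c, hc⟩ := h fun i => a (Fin.castLE hn i)
  -- Surplus points join part `0`; hulls only grow.
  refine ⟨fun i => if hi : (i : ℕ) < n then c ⟨i, hi⟩ else ⟨0, hr⟩, fun J hJ => ?_⟩
  refine (hc J hJ).mono (Set.iInter₂_mono fun j _ => convexHull_mono ?_)
  rintro _ ⟨i, hi, rfl⟩
  exact ⟨Fin.castLE hn i, by simpa using hi, rfl⟩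

theorem not_reayProperty_twelve : ¬ ReayProperty 5 3 2 12 := by
  intro h
  obtain ⟨p, hp⟩ := exists_isCenteredSimplex 5
  obtain ⟨ε₁, h₁⟩ := (eventually_injective_and_exists_disjoint (lam := fun _ b => (b : ℕ) + 1) hp
    (fun i j => by positivity) (fun i => by norm_num)).exists
  obtain ⟨ε₂, h₂⟩ := h₁.exists
  obtain ⟨ε₃, -, h₃⟩ := h₂.exists
  set P := perturbedPoints p (fun _ b => (b : ℕ) + 1) ε₁ ε₂ ε₃
  let φ : Fin 6 × Fin 2 ≃ Fin 12 := finProdFinEquiv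
  obtain ⟨c, hc⟩ := h (P ∘ φ.symm)
  obtain ⟨i, j, hij, hd⟩ := h₃ (c ∘ φ)
  obtain ⟨x, hx⟩ := hc {i, j} (Finset.card_pair hij)
  have hpart : ∀ k, partHull (P ∘ φ.symm) c k = partHull P (c ∘ φ) k := fun k => by
    unfold partHull
    congr 1
    ext y
    constructor
    · rintro ⟨s, hs, rfl⟩
      exact ⟨φ.symm s, by simpa using hs, rfl⟩
    · rintro ⟨s, hs, rfl⟩
      exact ⟨φ s, by simpa using hs, by simp⟩
  simp only [Finset.mem_insert, Finset.mem_singleton, Set.mem_iInter, hpart] at hx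
  exact Set.disjoint_left.1 hd (hx i (Or.inl rfl)) (hx j (Or.inr rfl))

end ReayNumber

theorem theorem5 :
    reayNumber 5 3 2 = tverbergNumber 5 3 ∧ tverbergNumber 5 3 = 13 ∧
      ∀ (p : Fin 6 → EuclideanSpace ℝ (Fin 5)) (lam : Fin 6 → Fin 2 → ℝ),
        IsCenteredSimplex p → (∀ i j, 0 < lam i j) → (∀ i, lam i 0 ≠ lam i 1) →
        ∀ᶠ ε₁ in 𝓝[>] (0 : ℝ), ∀ᶠ ε₂ in 𝓝[>] (0 : ℝ), ∀ᶠ ε₃ in 𝓝[>] (0 : ℝ),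
          Function.Injective (perturbedPoints p lam ε₁ ε₂ ε₃) ∧
          ∀ c : Fin 6 × Fin 2 → Fin 3, ∃ i j : Fin 3, i ≠ j ∧
            Disjoint (partHull (perturbedPoints p lam ε₁ ε₂ ε₃) c i)
              (partHull (perturbedPoints p lam ε₁ ε₂ ε₃) c j) := by
  refine ⟨le_antisymm ?_ ?_, rfl, fun p lam hp hpos hne =>
    eventually_injective_and_exists_disjoint hp hpos hne⟩
  · exact Nat.sInf_le ⟨by decide, reayProperty_tverbergNumber (by norm_num)⟩
  -- Nonemptiness matters, since `sInf ∅ = 0` in `ℕ`.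
  · refine le_csInf ⟨_, by decide, reayProperty_tverbergNumber (by norm_num)⟩ ?_
    rintro n ⟨-, hn⟩
    change 12 < n
    by_contra! hle
    exact not_reayProperty_twelve (hn.mono (by norm_num) hle)
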